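/- Let $(X_k)_{k\ge1}$ be an $\mathbb{R}^n$-valued stochastic process adapted to a filtration $(\mathcal F_k)_{k\ge1}$, let $\nu_\infty$ be a probability measure on $\mathbb{R}^n$ with finite second moment (the stationary distribution), and define $$\beta(k):=\sup_{t\ge1}\mathbb{E}\,\big\|\Pr_{X_{t+k}}(\cdot\mid\mathcal F_t)-\nu_\infty\big\|_{\mathrm{tv}},\qquad \|\mu-\nu\|_{\mathrm{tv}}=\sup_A|\mu(A)-\nu(A)|.$$ Suppose that $\beta(k)\le\Gamma\rho^k$ for all $k\ge1$, where $\Gamma>0$ and $\rho\in(0,1)$. Fix $\delta\in(0,1)$. For $X$ drawn from $\nu_\infty$ suppose that $$0<\ell\le\lambda_{\min}(\mathbb{E}[XX^{\mathsf T}])\le L,\qquad \sup_{t\in S^{n-1}}\frac{\|\langle X,t\rangle\|_{L^2}}{\|\langle X,t\rangle\|_{L^1}}\le B.$$ Let $N$ be a positive integer with $\frac{1}{1-\rho}\log\big(\frac{2\Gamma N}{\delta}\big)\ge\frac12$ (which holds automatically when $\Gamma\ge1$), and suppose that $$N\ge\frac{1}{1-\rho}\log\Big(\frac{2\Gamma N}{\delta}\Big)\left(\max\left\{65536\,B^6\,\frac{L}{\ell}\,n,\;512\,B^4\log\Big(\frac{4}{\delta(1-\rho)}\log\Big(\frac{2\Gamma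 N}{\delta}\Big)\Big)\right\}+1\right).$$ Then, with probability at least $1-\delta$, $$\lambda_{\min}\Big(\frac1N\sum_{k=1}^N X_kX_k^{\mathsf T}\Big)\ge\frac{\ell}{128B^4}.$$ -/

import Mathlib

open MeasureTheory ProbabilityTheory
open scoped ENNReal

namespace MixingCovariance

/-- Total variation distance of two measures, `sup_A |μ(A) - ν(A)|` over measurable sets `A`
(for probability measures it takes values in `[0, 1]`). -/
noncomputable def tvDist {E : Type*} [MeasurableSpace E] (μ ν : Measure E) : ℝ≥0∞ :=
  ⨆ (A : Set E) (_ : MeasurableSet A), ENNReal.ofReal |μ.real A - ν.real A|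

/-- A regular version of the conditional distribution `Pr(Y ∈ · | 𝓖)` of an `ℝⁿ`-valued random
vector `Y` given a sub-σ-algebra `𝓖`, as a Markov kernel on `(Ω, 𝓖)`. It is the regular
conditional distribution of `Y` given the identity map `Ω → (Ω, 𝓖)`. -/
noncomputable def condLaw {Ω : Type*} {m : MeasurableSpace Ω} (P : Measure Ω) [IsFiniteMeasure P]
    {n : ℕ} (Y : Ω → EuclideanSpace ℝ (Fin n)) (𝓖 : MeasurableSpace Ω) :
    @Kernel Ω (EuclideanSpace ℝ (Fin n)) 𝓖 _ :=
  @condDistrib Ω Ω (EuclideanSpace ℝ (Fin n)) _ _ _ m 𝓖 Y id P _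

/-- The `β`-mixing coefficient of the process `X₁, X₂, …` (the values `X 0` and `𝓕 0` play no role)
with respect to the measure `ν`:
`β(k) = sup_{t ≥ 1} 𝔼 ‖ Pr_{X_{t+k}}(· | 𝓕_t) - ν ‖_tv`. -/
noncomputable def betaMixing {Ω : Type*} {m : MeasurableSpace Ω} (P : Measure Ω)
    [IsFiniteMeasure P] {n : ℕ} (𝓕 : Filtration ℕ m) (X : ℕ → Ω → EuclideanSpace ℝ (Fin n))
    (ν : Measure (EuclideanSpace ℝ (Fin n))) (k : ℕ) : ℝ≥0∞ :=
  ⨆ (t : ℕ) (_ : 1 ≤ t), ∫⁻ ω, tvDist (condLaw P (X (t + k)) (𝓕 t) ω) ν ∂P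

/-- The smallest (real) eigenvalue of a real square matrix; it is used for symmetric matrices
only. -/
noncomputable def lambdaMin {n : ℕ} (A : Matrix (Fin n) (Fin n) ℝ) : ℝ :=
  sInf (spectrum ℝ A)

/-- The matrix `x xᵀ`. -/
def outer {n : ℕ} (x : EuclideanSpace ℝ (Fin n)) : Matrix (Fin n) (Fin n) ℝ :=
  Matrix.of fun i j => x i * x j

/-- The second moment matrix `𝔼_{x ∼ ν} [x xᵀ]` (entrywise expectation). -/
noncomputable def secondMoment {n : ℕ} (ν : Measure (EuclideanSpace ℝ (Fin n))) :
    Matrix (Fin n) (Fin n) ℝ :=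
  Matrix.of fun i j => ∫ x, outer x i j ∂ν

/-- The sample covariance matrix `(1/N) ∑_{k=1}^N x_k x_kᵀ`. -/
noncomputable def sampleCov {n : ℕ} (N : ℕ) (x : ℕ → EuclideanSpace ℝ (Fin n)) :
    Matrix (Fin n) (Fin n) ℝ :=
  (1 / (N : ℝ)) • ∑ k ∈ Finset.Icc 1 N, outer (x k)

/-- The `L²/L¹` contractivity constant
`sup_{t ∈ S^{n-1}} ‖⟨x, t⟩‖_{L²(ν)} / ‖⟨x, t⟩‖_{L¹(ν)}`. -/
noncomputable def contractivity {n : ℕ} (ν : Measure (EuclideanSpace ℝ (Fin n))) : ℝ≥0∞ :=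
  ⨆ (t : EuclideanSpace ℝ (Fin n)) (_ : ‖t‖ = 1),
    eLpNorm (fun x => inner ℝ x t) 2 ν / eLpNorm (fun x => inner ℝ x t) 1 ν

end MixingCovariance

/-! Whitening: with D the inverse square root of the second moment matrix, DX is isotropic under ν,
and ⟨X,t⟩ = c⟨a,DX⟩ with a a unit vector and c² ≥ ℓ. The L²/L¹ bound forces a truncated square
(`ramp`) of every marginal ⟨a,DX⟩ to have mean at least 1/(4B²). Since the ramp is bounded and
Lipschitz, its empirical sums have a lower tail uniform over the unit sphere that needs no moments
beyond the second.

Dependence is handled by splitting the sample into k interleaved subsequences of gap k ≈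
log(2ΓN/δ)/(1-ρ). Along one subsequence each term can be exchanged for a fresh draw from ν at cost
at most δ/(2N) in total variation (`lintegral_add_sum_le`). No coupling is built: a fresh draw is an
averaging operator acting on test functions, and m independent draws are its m-th iterate.

For those iterates, Hoeffding's lemma at each step gives bounded-difference concentration of the
maximum over a finite class (`iterate_shiftLAvg_exp_le`). Symmetrisation and contraction bound the
expected maximum by that of a linear process, which grows only like √m
(`iterate_shiftAvg_maxCoord_le`). Neither bound sees the size of the class, so it extends to the
whole sphere by density (`measure_exists_sum_ramp_lt_le`). A union bound over the k subsequences
finishes. -/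

namespace MixingCovariance

/-! ### Averaging operators and a class of convex functions stable under them -/

/-- The average of a function over random translates, `A ↦ ∫ f (A + ψ x) ∂ν`. -/
noncomputable def shiftAvg {ι E : Type*} [MeasurableSpace E] (ν : Measure E) (ψ : E → ι → ℝ)
    (f : (ι → ℝ) → ℝ) : (ι → ℝ) → ℝ :=
  fun A => ∫ x, f (A + ψ x) ∂ν

/-- The `ℝ≥0∞`-valued version of `shiftAvg`. -/
noncomputable def shiftLAvg {ι E : Type*} [MeasurableSpace E] (ν : Measure E) (ψ : E → ι → ℝ)
    (F : (ι → ℝ) → ℝ≥0∞) : (ι → ℝ) → ℝ≥0∞ :=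
  fun A => ∫⁻ x, F (A + ψ x) ∂ν

/-- The largest coordinate of a vector. -/
noncomputable def maxCoord {ι : Type*} [Fintype ι] [Nonempty ι] (A : ι → ℝ) : ℝ :=
  Finset.univ.sup' Finset.univ_nonempty A

/-- Convex `1`-Lipschitz functions on `ι → ℝ` whose symmetrised value increases under expansions
of the symmetrised vector. -/
structure ContractionMonotone {ι : Type*} [Fintype ι] (f : (ι → ℝ) → ℝ) : Prop where
  lipschitz : LipschitzWith 1 f
  convex : ConvexOn ℝ Set.univ f
  add_le_add : ∀ A b c : ι → ℝ, (∀ s t, |b s - b t| ≤ |c s - c t|) →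
    f (A + b) + f (A - b) ≤ f (A + c) + f (A - c)

section maxCoord

variable {ι : Type*} [Fintype ι] [Nonempty ι]

lemma le_maxCoord (A : ι → ℝ) (i : ι) : A i ≤ maxCoord A :=
  Finset.le_sup' A (Finset.mem_univ i)

lemma maxCoord_le {A : ι → ℝ} {c : ℝ} (h : ∀ i, A i ≤ c) : maxCoord A ≤ c :=
  Finset.sup'_le _ _ fun i _ => h i

lemma exists_maxCoord_eq (A : ι → ℝ) : ∃ i, maxCoord A = A i := by
  obtain ⟨i, -, hi⟩ := Finset.exists_mem_eq_sup' (Finset.univ_nonempty (α := ι)) A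
  exact ⟨i, hi⟩

lemma contractionMonotone_maxCoord : ContractionMonotone (maxCoord (ι := ι)) where
  lipschitz := by
    refine LipschitzWith.of_le_add fun A B => maxCoord_le fun i => ?_
    have h1 := le_maxCoord B i
    have h2 := dist_le_pi_dist A B i
    rw [Real.dist_eq] at h2
    linarith [le_abs_self (A i - B i)]
  convex := by
    refine ⟨convex_univ, fun A _ B _ a b ha hb _ => maxCoord_le fun i => ?_⟩
    simp only [Pi.add_apply, Pi.smul_apply, smul_eq_mul]
    gcongr <;> exact le_maxCoord _ i
  add_le_add A b c h := by
    obtain ⟨s, hs⟩ := exists_maxCoord_eq (A + b)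
    obtain ⟨t, ht⟩ := exists_maxCoord_eq (A - b)
    -- With maximisers s and t, the left side is at most A s + A t + |c s - c t|. The sign of c s -
    -- c t decides which of the two is tested in A + c and which in A - c.
    have h1 := le_maxCoord (A + c) s
    have h2 := le_maxCoord (A - c) t
    have h3 := le_maxCoord (A + c) t
    have h4 := le_maxCoord (A - c) s
    have h5 := (le_abs_self _).trans (h s t)
    simp only [Pi.add_apply, Pi.sub_apply] at *
    rcases abs_cases (c s - c t) with h6 | h6 <;> linarith [h6.1]

end maxCoord

/-! ### Symmetrisation, exponential moments and the expected maximum -/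

lemma shiftLAvg_mono {ι E : Type*} [MeasurableSpace E] {ν : Measure E} {ψ : E → ι → ℝ}
    {F G : (ι → ℝ) → ℝ≥0∞} (h : F ≤ G) : shiftLAvg ν ψ F ≤ shiftLAvg ν ψ G :=
  fun _ => lintegral_mono fun _ => h _

section shiftAvg

variable {ι E : Type*} [Fintype ι] [MeasurableSpace E] {ν : Measure E} [IsProbabilityMeasure ν]
  {ψ : E → ι → ℝ} {f : (ι → ℝ) → ℝ}

lemma integrable_comp_add (hf : LipschitzWith 1 f) (hψ : Integrable ψ ν) (A : ι → ℝ) :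
    Integrable (fun x => f (A + ψ x)) ν := by
  refine Integrable.mono' (g := fun x => |f A| + ‖ψ x‖) ((integrable_const _).add hψ.norm)
    (hf.continuous.comp_aestronglyMeasurable (hψ.1.const_add A)) (.of_forall fun x => ?_)
  have := hf.dist_le_mul (A + ψ x) A
  rw [Real.dist_eq, dist_eq_norm, add_sub_cancel_left] at this
  simp only [NNReal.coe_one, one_mul] at this
  rw [Real.norm_eq_abs]
  linarith [abs_sub_abs_le_abs_sub (f (A + ψ x)) (f A)]

lemma lipschitzWith_shiftAvg (hf : LipschitzWith 1 f) (hψ : Integrable ψ ν) :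
    LipschitzWith 1 (shiftAvg ν ψ f) := by
  refine LipschitzWith.of_le_add fun A B => ?_
  have : shiftAvg ν ψ f B + dist A B = ∫ x, (f (B + ψ x) + dist A B) ∂ν := by
    rw [integral_add (integrable_comp_add hf hψ B) (integrable_const _)]
    simp [shiftAvg]
  rw [this]
  refine integral_mono (integrable_comp_add hf hψ A)
    ((integrable_comp_add hf hψ B).add (integrable_const _)) fun x => ?_
  have := hf.dist_le_mul (A + ψ x) (B + ψ x)
  rw [dist_add_right, Real.dist_eq] at this
  simp only [NNReal.coe_one, one_mul] at this
  change f (A + ψ x) ≤ f (B + ψ x) + dist A B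
  linarith [le_abs_self (f (A + ψ x) - f (B + ψ x))]

protected lemma ContractionMonotone.shiftAvg (hf : ContractionMonotone f) (hψ : Integrable ψ ν) :
    ContractionMonotone (shiftAvg ν ψ f) where
  lipschitz := lipschitzWith_shiftAvg hf.lipschitz hψ
  convex := by
    have hi := integrable_comp_add hf.lipschitz hψ
    refine ⟨convex_univ, fun A _ B _ a b ha hb hab => ?_⟩
    simp only [shiftAvg, smul_eq_mul]
    rw [← integral_const_mul, ← integral_const_mul,
      ← integral_add ((hi A).const_mul a) ((hi B).const_mul b)]
    refine integral_mono (hi _) (((hi A).const_mul a).add ((hi B).const_mul b)) fun x => ?_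
    have := hf.convex.2 (Set.mem_univ (A + ψ x)) (Set.mem_univ (B + ψ x)) ha hb hab
    have h2 : a • (A + ψ x) + b • (B + ψ x) = a • A + b • B + ψ x := by
      rw [smul_add, smul_add, add_add_add_comm, ← add_smul, hab, one_smul]
    rwa [h2] at this
  add_le_add A b c h := by
    have hi := integrable_comp_add hf.lipschitz hψ
    simp only [shiftAvg]
    rw [← integral_add (hi _) (hi _), ← integral_add (hi _) (hi _)]
    refine integral_mono ((hi _).add (hi _)) ((hi _).add (hi _)) fun x => ?_
    have := hf.add_le_add (A + ψ x) b c h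
    simpa only [add_right_comm A, sub_add_eq_add_sub] using this

lemma ContractionMonotone.iterate_shiftAvg (hf : ContractionMonotone f) (hψ : Integrable ψ ν)
    (m : ℕ) : ContractionMonotone ((shiftAvg ν ψ)^[m] f) := by
  induction m with
  | zero => exact hf
  | succ m ih => rw [Function.iterate_succ_apply']; exact ih.shiftAvg hψ

/-- Symmetrisation and contraction in one step. -/
lemma ContractionMonotone.shiftAvg_sub_le (hf : ContractionMonotone f) {φ c : E → ι → ℝ}
    (hφ : Integrable φ ν) (hc : Integrable c ν)
    (h : ∀ x s t, |2 * φ x s - 2 * φ x t| ≤ |c x s - c x t|) (A : ι → ℝ) :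
    shiftAvg ν (fun x => (∫ y, φ y ∂ν) - φ x) f A ≤
      ∫ x, (f (A + c x) + f (A - c x)) / 2 ∂ν := by
  set μ := ∫ y, φ y ∂ν with hμ
  have i1 : Integrable (fun x => f (A + (μ - φ x))) ν :=
    integrable_comp_add hf.lipschitz ((integrable_const μ).sub hφ) A
  have i2 : Integrable (fun x => f (A + (2 : ℝ) • φ x)) ν :=
    integrable_comp_add hf.lipschitz (hφ.smul (2 : ℝ)) A
  have i3 : Integrable (fun x => f (A - (2 : ℝ) • φ x)) ν := by
    simpa only [sub_eq_add_neg, Pi.neg_apply, Pi.smul_apply] using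
      integrable_comp_add hf.lipschitz (hφ.smul (2 : ℝ)).neg A
  have i4 : Integrable (fun x => f (A + c x)) ν := integrable_comp_add hf.lipschitz hc A
  have i5 : Integrable (fun x => f (A - c x)) ν := by
    simpa only [sub_eq_add_neg, Pi.neg_apply] using integrable_comp_add hf.lipschitz hc.neg A
  have jensen : f (A + (2 : ℝ) • μ) ≤ ∫ x, f (A + (2 : ℝ) • φ x) ∂ν := by
    have := hf.convex.map_integral_le (f := fun x => A + (2 : ℝ) • φ x) (μ := ν)
      hf.lipschitz.continuous.continuousOn isClosed_univ (.of_forall fun _ => Set.mem_univ _)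
      ((integrable_const A).add (hφ.smul (2 : ℝ))) i2
    have e : ∫ x, (A + (2 : ℝ) • φ x) ∂ν = A + (2 : ℝ) • μ := by
      have := integral_add (μ := ν) (integrable_const A) (hφ.smul (2 : ℝ))
      simp only [Pi.smul_apply, integral_smul, integral_const, probReal_univ, one_smul] at this
      rw [hμ, ← this]
    rwa [e] at this
  -- A + μ - φ is the midpoint of A + 2μ and A - 2φ. Jensen then replaces μ by φ at the same point
  -- x, so no independent copy is needed for the symmetrisation.
  calc ∫ x, f (A + (μ - φ x)) ∂ν
      ≤ ∫ x, (f (A + (2 : ℝ) • μ) + f (A - (2 : ℝ) • φ x)) / 2 ∂ν := by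
        refine integral_mono i1 (((integrable_const _).add i3).div_const 2) fun x => ?_
        have := hf.convex.2 (Set.mem_univ (A + (2 : ℝ) • μ)) (Set.mem_univ (A - (2 : ℝ) • φ x))
          (show (0 : ℝ) ≤ 1 / 2 by norm_num) (show (0 : ℝ) ≤ 1 / 2 by norm_num) (by norm_num)
        have e : (1 / 2 : ℝ) • (A + (2 : ℝ) • μ) + (1 / 2 : ℝ) • (A - (2 : ℝ) • φ x)
            = A + (μ - φ x) := by
          ext i; simp only [Pi.add_apply, Pi.sub_apply, Pi.smul_apply, smul_eq_mul]; ring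
        rw [e, smul_eq_mul, smul_eq_mul] at this
        change f (A + (μ - φ x)) ≤ (f (A + (2 : ℝ) • μ) + f (A - (2 : ℝ) • φ x)) / 2
        linarith
    _ ≤ ∫ x, (f (A + (2 : ℝ) • φ x) + f (A - (2 : ℝ) • φ x)) / 2 ∂ν := by
        rw [integral_div, integral_div, integral_add (integrable_const _) i3, integral_add i2 i3]
        simp only [integral_const, probReal_univ, one_smul]
        linarith
    _ ≤ _ := by
        refine integral_mono ((i2.add i3).div_const 2) ((i4.add i5).div_const 2) fun x => ?_
        have := hf.add_le_add A ((2 : ℝ) • φ x) (c x) (h x)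
        change (f (A + (2 : ℝ) • φ x) + f (A - (2 : ℝ) • φ x)) / 2
          ≤ (f (A + c x) + f (A - c x)) / 2
        linarith

/-- Hoeffding's lemma for one random translation. -/
lemma shiftLAvg_exp_le (hf : LipschitzWith 1 f) (hψ : Integrable ψ ν) {c : ι → ℝ}
    (hc : ∀ x i, |ψ x i - c i| ≤ 1 / 2) (θ d : ℝ) (A : ι → ℝ) :
    shiftLAvg ν ψ (fun B => ENNReal.ofReal (Real.exp (θ * f B + d))) A ≤
      ENNReal.ofReal (Real.exp (θ * shiftAvg ν ψ f A + (d + θ ^ 2 / 8))) := by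
  have hi := integrable_comp_add hf hψ A
  -- The Lipschitz bound in the sup norm confines the values to an interval of length 1, whatever
  -- the number of coordinates; hence θ²/8.
  have hm : ∀ᵐ x ∂ν, f (A + ψ x) ∈ Set.Icc (f (A + c) - 1 / 2) (f (A + c) + 1 / 2) := by
    refine .of_forall fun x => ?_
    have h1 := hf.dist_le_mul (A + ψ x) (A + c)
    have h2 : dist (ψ x) c ≤ 1 / 2 :=
      (dist_pi_le_iff (by norm_num)).2 fun i => by rw [Real.dist_eq]; exact hc x i
    rw [dist_add_left, Real.dist_eq] at h1
    simp only [NNReal.coe_one, one_mul] at h1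
    have := abs_le.1 (h1.trans h2)
    constructor <;> linarith [this.1, this.2]
  have hs := hasSubgaussianMGF_of_mem_Icc hi.aemeasurable hm
  have hle := hs.mgf_le θ
  have hint := hs.integrable_exp_mul θ
  have e : ∀ x, Real.exp (θ * f (A + ψ x) + d) = Real.exp (θ * shiftAvg ν ψ f A + d) *
      Real.exp (θ * (f (A + ψ x) - shiftAvg ν ψ f A)) := fun x => by
    rw [← Real.exp_add]; ring_nf
  have hI : Integrable (fun x => Real.exp (θ * f (A + ψ x) + d)) ν := by
    simp_rw [e]; exact hint.const_mul _
  simp only [shiftLAvg]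
  rw [← ofReal_integral_eq_lintegral_ofReal hI (.of_forall fun x => (Real.exp_pos _).le)]
  refine ENNReal.ofReal_le_ofReal ?_
  simp_rw [e]
  rw [integral_const_mul, ← add_assoc, Real.exp_add _ (θ ^ 2 / 8)]
  refine mul_le_mul_of_nonneg_left (hle.trans_eq ?_) (Real.exp_pos _).le
  congr 1
  have : f (A + c) + 1 / 2 - (f (A + c) - 1 / 2) = 1 := by ring
  rw [this]
  simp
  ring

/-- The bounded-difference martingale argument: each averaging moves inside the exponential at cost
θ²/8 and leaves a function that is again 1-Lipschitz. -/
lemma iterate_shiftLAvg_exp_le (hψ : Integrable ψ ν) {c : ι → ℝ}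
    (hc : ∀ x i, |ψ x i - c i| ≤ 1 / 2) (θ : ℝ) (m : ℕ) (hf : LipschitzWith 1 f) (d : ℝ)
    (A : ι → ℝ) :
    (shiftLAvg ν ψ)^[m] (fun B => ENNReal.ofReal (Real.exp (θ * f B + d))) A ≤
      ENNReal.ofReal (Real.exp (θ * (shiftAvg ν ψ)^[m] f A + (d + m * (θ ^ 2 / 8)))) := by
  induction m generalizing f d with
  | zero => simp
  | succ m ih =>
    rw [Function.iterate_succ_apply, Function.iterate_succ_apply]
    have hmono : Monotone (shiftLAvg ν ψ)^[m] := Monotone.iterate (fun _ _ => shiftLAvg_mono) m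
    refine (hmono (fun B => shiftLAvg_exp_le hf hψ hc θ d B) A).trans ?_
    refine (ih (lipschitzWith_shiftAvg hf hψ) (d + θ ^ 2 / 8)).trans_eq ?_
    push_cast
    ring_nf

lemma integral_sqrt_le {h : E → ℝ} (h0 : ∀ x, 0 ≤ h x) (hi : Integrable h ν) :
    Integrable (fun x => √(h x)) ν ∧ ∫ x, √(h x) ∂ν ≤ √(∫ x, h x ∂ν) := by
  have hs : Integrable (fun x => √(h x)) ν := by
    refine Integrable.mono' (hi.add (integrable_const 1))
      (Real.continuous_sqrt.comp_aestronglyMeasurable hi.1) (.of_forall fun x => ?_)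
    rw [Real.norm_of_nonneg (Real.sqrt_nonneg _)]
    change √(h x) ≤ h x + 1
    nlinarith [Real.sq_sqrt (h0 x), sq_nonneg (√(h x) - 1), Real.sqrt_nonneg (h x)]
  exact ⟨hs, Real.strictConcaveOn_sqrt.concaveOn.le_map_integral
    Real.continuous_sqrt.continuousOn isClosed_Ici (.of_forall h0) hi hs⟩

/-- The expected maximum of the centred process, started at the linear functional `w`. -/
lemma iterate_shiftAvg_maxCoord_le [Nonempty ι] {H : Type*} [NormedAddCommGroup H]
    [InnerProductSpace ℝ H] {φ : E → ι → ℝ} (hφ : Integrable φ ν) {a : ι → H}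
    (ha : ∀ i, ‖a i‖ ≤ 1) {z : E → H} (hz : MemLp z 2 ν)
    (h : ∀ x s t, |2 * φ x s - 2 * φ x t| ≤ |inner ℝ (a s) (z x) - inner ℝ (a t) (z x)|)
    {K : ℝ} (hK : ∫ x, ‖z x‖ ^ 2 ∂ν ≤ K) (m : ℕ) (w : H) :
    (shiftAvg ν (fun x => (∫ y, φ y ∂ν) - φ x))^[m] maxCoord (fun i => inner ℝ (a i) w) ≤
      √(‖w‖ ^ 2 + m * K) := by
  have hK0 : 0 ≤ K := (integral_nonneg fun x => by positivity).trans hK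
  -- Contraction turns a step into w ↦ w ± z, so the starting vector stays a linear functional of w.
  -- By the parallelogram law and concavity of the square root, the quantity under the root grows by
  -- at most K per step.
  induction m generalizing w with
  | zero =>
    simp only [Function.iterate_zero, id_eq, CharP.cast_eq_zero, zero_mul, add_zero,
      Real.sqrt_sq (norm_nonneg w)]
    exact maxCoord_le fun i => (real_inner_le_norm _ _).trans
      (mul_le_of_le_one_left (norm_nonneg _) (ha i))
  | succ m ih =>
    rw [Function.iterate_succ_apply']
    set G := (shiftAvg ν (fun x => (∫ y, φ y ∂ν) - φ x))^[m] maxCoord with hG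
    have hψ : Integrable (fun x => (∫ y, φ y ∂ν) - φ x) ν := (integrable_const _).sub hφ
    have hGc : ContractionMonotone G :=
      ContractionMonotone.iterate_shiftAvg contractionMonotone_maxCoord hψ m
    have hzi : Integrable z ν := hz.integrable (by norm_num)
    have hc : Integrable (fun x i => inner ℝ (a i) (z x)) ν :=
      Integrable.of_eval fun i => hzi.const_inner (a i)
    refine (hGc.shiftAvg_sub_le hφ hc h _).trans ?_
    have hz2 : Integrable (fun x => ‖z x‖ ^ 2) ν := hz.integrable_norm_pow (by norm_num)
    have hR : Integrable (fun x => ‖z x‖ ^ 2 + (‖w‖ ^ 2 + m * K)) ν :=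
      hz2.add (integrable_const _)
    obtain ⟨j1, j2⟩ := integral_sqrt_le (fun x => by positivity) hR
    have i4 := integrable_comp_add hGc.lipschitz hc (fun i => inner ℝ (a i) w)
    have i5 : Integrable (fun x => G ((fun i => inner ℝ (a i) w) -
        fun i => inner ℝ (a i) (z x))) ν := by
      simpa only [sub_eq_add_neg, Pi.neg_apply] using
        integrable_comp_add hGc.lipschitz hc.neg (fun i => inner ℝ (a i) w)
    refine (integral_mono ((i4.add i5).div_const 2) j1 fun x => ?_).trans (j2.trans ?_)
    · have h1 := ih (w + z x)
      have h2 := ih (w - z x)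
      have e1 : (fun i => inner ℝ (a i) (w + z x)) =
          (fun i => inner ℝ (a i) w) + fun i => inner ℝ (a i) (z x) := by
        ext i; simp [inner_add_right]
      have e2 : (fun i => inner ℝ (a i) (w - z x)) =
          (fun i => inner ℝ (a i) w) - fun i => inner ℝ (a i) (z x) := by
        ext i; simp [inner_sub_right]
      rw [e1] at h1
      rw [e2] at h2
      change (G _ + G _) / 2 ≤ √(‖z x‖ ^ 2 + (‖w‖ ^ 2 + m * K))
      refine (div_le_div_of_nonneg_right (add_le_add h1 h2) two_pos.le).trans ?_
      refine Real.le_sqrt_of_sq_le ?_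
      have p := parallelogram_law_with_norm ℝ w (z x)
      have q1 := Real.sq_sqrt (show 0 ≤ ‖w + z x‖ ^ 2 + m * K by positivity)
      have q2 := Real.sq_sqrt (show 0 ≤ ‖w - z x‖ ^ 2 + m * K by positivity)
      nlinarith [sq_nonneg (√(‖w + z x‖ ^ 2 + m * K) - √(‖w - z x‖ ^ 2 + m * K))]
    · refine Real.sqrt_le_sqrt ?_
      rw [integral_add hz2 (integrable_const _)]
      simp only [integral_const, probReal_univ, one_smul]
      push_cast
      linarith

end shiftAvg

/-! ### Total variation and replacement by independent draws -/

lemma measure_le_add_tvDist {E : Type*} [MeasurableSpace E] (μ ν : Measure E)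
    [IsFiniteMeasure μ] [IsFiniteMeasure ν] {A : Set E} (hA : MeasurableSet A) :
    μ A ≤ ν A + tvDist μ ν := by
  have h : ENNReal.ofReal |μ.real A - ν.real A| ≤ tvDist μ ν :=
    le_iSup₂ (f := fun (A : Set E) (_ : MeasurableSet A) =>
      ENNReal.ofReal |μ.real A - ν.real A|) A hA
  refine le_trans ?_ (add_le_add_right h (ν A))
  rw [← ofReal_measureReal (μ := μ), ← ofReal_measureReal (μ := ν),
    ← ENNReal.ofReal_add measureReal_nonneg (abs_nonneg _)]
  exact ENNReal.ofReal_le_ofReal (by linarith [le_abs_self (μ.real A - ν.real A)])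

/-- Layer cake: only levels in (0,1] contribute, and each superlevel set costs one total variation
distance, so the constant is 1. -/
lemma lintegral_le_add_tvDist {E : Type*} [MeasurableSpace E] (μ ν : Measure E)
    [IsFiniteMeasure μ] [IsFiniteMeasure ν] {f : E → ℝ≥0∞} (hf : Measurable f)
    (h1 : ∀ x, f x ≤ 1) : ∫⁻ x, f x ∂μ ≤ ∫⁻ x, f x ∂ν + tvDist μ ν := by
  have hlt : ∀ x, f x ≠ ∞ := fun x => ((h1 x).trans_lt ENNReal.one_lt_top).ne
  have layer : ∀ (η : Measure E), ∫⁻ x, f x ∂η =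
      ∫⁻ t in Set.Ioc (0 : ℝ) 1, η {x | t ≤ (f x).toReal} := by
    intro η
    have e1 : ∫⁻ x, f x ∂η = ∫⁻ x, ENNReal.ofReal (f x).toReal ∂η :=
      lintegral_congr fun x => (ENNReal.ofReal_toReal (hlt x)).symm
    rw [e1, lintegral_eq_lintegral_meas_le η (.of_forall fun x => ENNReal.toReal_nonneg)
      hf.ennreal_toReal.aemeasurable, ← Set.Ioc_union_Ioi_eq_Ioi zero_le_one,
      lintegral_union measurableSet_Ioi
        (Set.disjoint_left.2 fun t ht ht' => not_lt.2 ht.2 ht')]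
    convert add_zero _
    rw [← lintegral_zero (μ := volume.restrict (Set.Ioi (1 : ℝ)))]
    refine setLIntegral_congr_fun measurableSet_Ioi fun t ht => ?_
    have : {x | t ≤ (f x).toReal} = ∅ := by
      ext x
      simp only [Set.mem_ofPred_eq, Set.mem_empty_iff_false, iff_false, not_le]
      exact (ENNReal.toReal_mono ENNReal.one_ne_top (h1 x)).trans_lt ht
    simp [this]
  rw [layer μ, layer ν]
  calc ∫⁻ t in Set.Ioc (0 : ℝ) 1, μ {x | t ≤ (f x).toReal}
      ≤ ∫⁻ t in Set.Ioc (0 : ℝ) 1, (ν {x | t ≤ (f x).toReal} + tvDist μ ν) :=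
        lintegral_mono fun t =>
          measure_le_add_tvDist μ ν (measurableSet_le measurable_const hf.ennreal_toReal)
    _ = _ := by
        rw [lintegral_add_right _ measurable_const]
        simp

lemma lintegral_prodMk_le_add_tvDist {Ω Ω' E : Type*} {mΩ : MeasurableSpace Ω}
    {mΩ' : MeasurableSpace Ω'} [MeasurableSpace E] [StandardBorelSpace E] [Nonempty E]
    (P : Measure Ω) [IsFiniteMeasure P] {X : Ω → Ω'} (hX : Measurable X) {Y : Ω → E}
    (hY : Measurable Y) (ν : Measure E) [IsFiniteMeasure ν] {F : Ω' × E → ℝ≥0∞}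
    (hF : Measurable F) (h1 : ∀ p, F p ≤ 1) :
    ∫⁻ ω, F (X ω, Y ω) ∂P ≤
      ∫⁻ ω, ∫⁻ y, F (X ω, y) ∂ν ∂P + ∫⁻ ω, tvDist (condDistrib Y X P (X ω)) ν ∂P := by
  have hm : Measurable fun x => ∫⁻ y, F (x, y) ∂ν := hF.lintegral_prod_right'
  have hk : Measurable fun x => ∫⁻ y, F (x, y) ∂(condDistrib Y X P x) :=
    hF.lintegral_kernel_prod_right'
  rw [← lintegral_map hF (hX.prodMk hY), ← compProd_map_condDistrib hY.aemeasurable,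
    Measure.lintegral_compProd hF, lintegral_map hk hX,
    ← lintegral_add_left (show Measurable fun ω => ∫⁻ y, F (X ω, y) ∂ν from hm.comp hX)]
  exact lintegral_mono fun ω =>
    lintegral_le_add_tvDist _ ν (hF.comp measurable_prodMk_left) fun y => h1 _

lemma lintegral_comp_prodMk_le_add_tvDist {Ω Ω' E : Type*} {mΩ : MeasurableSpace Ω}
    {mΩ' : MeasurableSpace Ω'} [MeasurableSpace E] [StandardBorelSpace E] [Nonempty E]
    (P : Measure Ω) [IsFiniteMeasure P] {X : Ω → Ω'} (hX : Measurable X) {Y : Ω → E}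
    (hY : Measurable Y) (ν : Measure E) [IsFiniteMeasure ν] {V : Type*} [MeasurableSpace V]
    {S : Ω' → V} (hS : Measurable S) {F : V × E → ℝ≥0∞} (hF : Measurable F) (h1 : ∀ p, F p ≤ 1) :
    ∫⁻ ω, F (S (X ω), Y ω) ∂P ≤
      ∫⁻ ω, ∫⁻ y, F (S (X ω), y) ∂ν ∂P + ∫⁻ ω, tvDist (condDistrib Y X P (X ω)) ν ∂P :=
  lintegral_prodMk_le_add_tvDist P hX hY ν (F := fun p => F (S p.1, p.2))
    (hF.comp ((hS.comp measurable_fst).prodMk measurable_snd)) fun _ => h1 _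

/-- The conditioning variable is the identity from Ω to (Ω, 𝓖), which is how `condLaw` is defined; S
may then be any 𝓖-measurable statistic of the past. -/
lemma lintegral_le_add_tvDist_condLaw {Ω : Type*} {m : MeasurableSpace Ω} (P : Measure Ω)
    [IsFiniteMeasure P] {n : ℕ} {Y : Ω → EuclideanSpace ℝ (Fin n)} (hY : Measurable Y)
    {𝓖 : MeasurableSpace Ω} (h𝓖 : 𝓖 ≤ m) (ν : Measure (EuclideanSpace ℝ (Fin n)))
    [IsFiniteMeasure ν] {V : Type*} [MeasurableSpace V] {S : Ω → V} (hS : Measurable[𝓖] S)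
    {F : V × EuclideanSpace ℝ (Fin n) → ℝ≥0∞} (hF : Measurable F) (h1 : ∀ p, F p ≤ 1) :
    ∫⁻ ω, F (S ω, Y ω) ∂P ≤
      ∫⁻ ω, ∫⁻ y, F (S ω, y) ∂ν ∂P + ∫⁻ ω, tvDist (condLaw P Y 𝓖 ω) ν ∂P := by
  exact @lintegral_comp_prodMk_le_add_tvDist Ω Ω _ m 𝓖 _ _ _ P _ id (measurable_id'' h𝓖) Y hY ν _
    V _ S hS F hF h1

/-- Replacing a mixing sequence by an independent one with marginal law `ν`, one term at a time. -/
lemma lintegral_add_sum_le {Ω : Type*} {mΩ : MeasurableSpace Ω} (P : Measure Ω)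
    [IsProbabilityMeasure P] {n : ℕ} (𝓖 : Filtration ℕ mΩ)
    {Y : ℕ → Ω → EuclideanSpace ℝ (Fin n)} (hY : ∀ i, Measurable[𝓖 i] (Y i))
    (ν : Measure (EuclideanSpace ℝ (Fin n))) [IsProbabilityMeasure ν] {β : ℝ≥0∞}
    (hβ : ∀ i, ∫⁻ ω, tvDist (condLaw P (Y (i + 1)) (𝓖 i) ω) ν ∂P ≤ β)
    {ι : Type*} [Fintype ι] {ψ : EuclideanSpace ℝ (Fin n) → ι → ℝ} (hψ : Measurable ψ)
    (A : ι → ℝ) (m : ℕ) {F : (ι → ℝ) → ℝ≥0∞} (hF : Measurable F) (h1 : ∀ B, F B ≤ 1) :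
    ∫⁻ ω, F (A + ∑ i ∈ Finset.range m, ψ (Y (i + 1) ω)) ∂P ≤
      (shiftLAvg ν ψ)^[m] F A + m * β := by
  induction m generalizing F with
  | zero => simp
  | succ m ih =>
    -- The last term is exchanged first, given the past at time m; averaging it out leaves another
    -- test function bounded by 1. Y 0 is never summed: time 0 only starts the conditioning.
    have hS : Measurable[𝓖 m] fun ω => A + ∑ i ∈ Finset.range m, ψ (Y (i + 1) ω) :=
      measurable_const.add (Finset.measurable_fun_sum _ fun i hi =>
        hψ.comp ((hY (i + 1)).mono (𝓖.mono (Finset.mem_range.1 hi)) le_rfl))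
    have hK : Measurable (Function.uncurry fun (B : ι → ℝ) (y : EuclideanSpace ℝ (Fin n)) =>
        F (B + ψ y)) :=
      hF.comp (measurable_fst.add (hψ.comp measurable_snd))
    have step := lintegral_le_add_tvDist_condLaw P ((hY (m + 1)).mono (𝓖.le _) le_rfl)
      (𝓖.le m) ν hS hK fun p => h1 _
    simp only [Function.uncurry_apply_pair] at step
    simp_rw [Finset.sum_range_succ, ← add_assoc]
    refine (step.trans (add_le_add (ih (F := shiftLAvg ν ψ F) hK.lintegral_prod_right' fun B => ?_)
      (hβ m))).trans_eq ?_
    · exact (lintegral_mono fun y => h1 _).trans (by simp)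
    · rw [Function.iterate_succ_apply]
      push_cast
      ring

/-! ### Uniform lower tail over a finite class -/

/-- Uniform lower tail bound over a finite class, for a mixing sequence. -/
lemma measure_le_maxCoord_sum_le {Ω : Type*} {mΩ : MeasurableSpace Ω} (P : Measure Ω)
    [IsProbabilityMeasure P] {n : ℕ} (𝓖 : Filtration ℕ mΩ)
    {Y : ℕ → Ω → EuclideanSpace ℝ (Fin n)} (hY : ∀ i, Measurable[𝓖 i] (Y i))
    (ν : Measure (EuclideanSpace ℝ (Fin n))) [IsProbabilityMeasure ν] {β : ℝ≥0∞}
    (hβ : ∀ i, ∫⁻ ω, tvDist (condLaw P (Y (i + 1)) (𝓖 i) ω) ν ∂P ≤ β)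
    {ι : Type*} [Fintype ι] [Nonempty ι] {H : Type*} [NormedAddCommGroup H]
    [InnerProductSpace ℝ H] {φ : EuclideanSpace ℝ (Fin n) → ι → ℝ} (hφ : Measurable φ)
    (hφ01 : ∀ x i, φ x i ∈ Set.Icc (0 : ℝ) 1) {a : ι → H} (ha : ∀ i, ‖a i‖ ≤ 1)
    {z : EuclideanSpace ℝ (Fin n) → H} (hz : MemLp z 2 ν)
    (h : ∀ x s t, |2 * φ x s - 2 * φ x t| ≤ |inner ℝ (a s) (z x) - inner ℝ (a t) (z x)|)
    {K : ℝ} (hK : ∫ x, ‖z x‖ ^ 2 ∂ν ≤ K) (m : ℕ) (s θ : ℝ) (hθ : 0 ≤ θ) :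
    P {ω | s ≤ maxCoord (∑ i ∈ Finset.range m, ((∫ y, φ y ∂ν) - φ (Y (i + 1) ω)))} ≤
      ENNReal.ofReal (Real.exp (θ * √(m * K) + m * (θ ^ 2 / 8) - θ * s)) + m * β := by
  set ψ : EuclideanSpace ℝ (Fin n) → ι → ℝ := fun x => (∫ y, φ y ∂ν) - φ x with hψdef
  have hψ : Measurable ψ := measurable_const.sub hφ
  have hφi : Integrable φ ν := Integrable.of_eval fun i =>
    Integrable.of_mem_Icc 0 1 ((measurable_pi_apply i).comp hφ).aemeasurable
      (.of_forall fun x => hφ01 x i)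
  have hψi : Integrable ψ ν := (integrable_const _).sub hφi
  have hmm : Measurable (maxCoord (ι := ι)) :=
    contractionMonotone_maxCoord.lipschitz.continuous.measurable
  have hset : MeasurableSet {B : ι → ℝ | s ≤ maxCoord B} := measurableSet_le measurable_const hmm
  have hc : ∀ x i, |ψ x i - ((∫ y, φ y ∂ν) i - 1 / 2)| ≤ 1 / 2 := fun x i => by
    have := hφ01 x i
    simp only [hψdef, Pi.sub_apply]
    rw [abs_le]
    constructor <;> linarith [this.1, this.2]
  -- The exchange needs a test function bounded by 1, so it is done for the indicator; the
  -- exponential majorant enters only afterwards.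
  set F : (ι → ℝ) → ℝ≥0∞ := Set.indicator {B | s ≤ maxCoord B} 1 with hF
  have step := lintegral_add_sum_le P 𝓖 hY ν hβ hψ 0 m (F := F) (measurable_one.indicator hset)
    fun B => Set.indicator_le_self' (fun _ _ => zero_le) B
  have hYm : ∀ i, Measurable (Y i) := fun i => (hY i).mono (𝓖.le _) le_rfl
  have hSm : Measurable fun ω => ∑ i ∈ Finset.range m, ψ (Y (i + 1) ω) :=
    Finset.measurable_fun_sum _ fun i _ => hψ.comp (hYm (i + 1))
  have e : ∫⁻ ω, F (0 + ∑ i ∈ Finset.range m, ψ (Y (i + 1) ω)) ∂P =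
      P {ω | s ≤ maxCoord (∑ i ∈ Finset.range m, ψ (Y (i + 1) ω))} := by
    have hSset : MeasurableSet {ω | s ≤ maxCoord (∑ i ∈ Finset.range m, ψ (Y (i + 1) ω))} :=
      hSm hset
    rw [← lintegral_indicator_one hSset]
    refine lintegral_congr fun ω => ?_
    rw [zero_add]
    rfl
  rw [e] at step
  refine step.trans (add_le_add_left ?_ _)
  have hle : F ≤ fun B => ENNReal.ofReal (Real.exp (θ * maxCoord B + -(θ * s))) := fun B => by
    by_cases hB : s ≤ maxCoord B
    · rw [hF, Set.indicator_of_mem (show B ∈ {B : ι → ℝ | s ≤ maxCoord B} from hB), Pi.one_apply,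
        ← ENNReal.ofReal_one]
      refine ENNReal.ofReal_le_ofReal (Real.one_le_exp ?_)
      nlinarith
    · rw [hF, Set.indicator_of_notMem (show B ∉ {B : ι → ℝ | s ≤ maxCoord B} from hB)]
      exact zero_le
  have hmono : Monotone (shiftLAvg ν ψ)^[m] := Monotone.iterate (fun _ _ => shiftLAvg_mono) m
  refine (hmono hle 0).trans ((iterate_shiftLAvg_exp_le hψi hc θ m
    contractionMonotone_maxCoord.lipschitz _ 0).trans ?_)
  refine ENNReal.ofReal_le_ofReal (Real.exp_le_exp.2 ?_)
  have hG := iterate_shiftAvg_maxCoord_le hφi ha hz h hK m 0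
  have h0 : (fun i => inner ℝ (a i) (0 : H)) = 0 := by ext i; simp
  rw [h0, norm_zero] at hG
  have := mul_le_mul_of_nonneg_left hG hθ
  rw [zero_pow two_ne_zero, zero_add] at this
  linarith

/-! ### The truncated marginal and its mean -/

/-- A Lipschitz minorant of the indicator of `{|s| ≥ 1 / (4 B)}` which majorises the indicator of
`{|s| ≥ 1 / (2 B)}`. -/
noncomputable def ramp (B s : ℝ) : ℝ := max 0 (min 1 (4 * B * |s| - 1))

lemma ramp_mem_Icc (B s : ℝ) : ramp B s ∈ Set.Icc (0 : ℝ) 1 :=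
  ⟨le_max_left _ _, max_le zero_le_one (min_le_left _ _)⟩

lemma continuous_ramp (B : ℝ) : Continuous (ramp B) := by
  unfold ramp; fun_prop

lemma abs_ramp_sub_le {B : ℝ} (hB : 0 ≤ B) (s t : ℝ) :
    |ramp B s - ramp B t| ≤ 4 * B * |s - t| := by
  have h1 : |ramp B s - ramp B t| ≤ |min 1 (4 * B * |s| - 1) - min 1 (4 * B * |t| - 1)| := by
    simpa only [ramp, max_comm (0 : ℝ)] using abs_max_sub_max_le_abs (min 1 (4 * B * |s| - 1))
      (min 1 (4 * B * |t| - 1)) 0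
  have h2 : |min 1 (4 * B * |s| - 1) - min 1 (4 * B * |t| - 1)| ≤
      |(4 * B * |s| - 1) - (4 * B * |t| - 1)| := by
    simpa using abs_min_sub_min_le_max (1 : ℝ) (4 * B * |s| - 1) 1 (4 * B * |t| - 1)
  have h3 : (4 * B * |s| - 1) - (4 * B * |t| - 1) = 4 * B * (|s| - |t|) := by ring
  rw [h3, abs_mul, abs_of_nonneg (by positivity : 0 ≤ 4 * B)] at h2
  exact (h1.trans h2).trans
    (mul_le_mul_of_nonneg_left (abs_abs_sub_abs_le_abs_sub s t) (by positivity))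

lemma ramp_le_sq (B s : ℝ) : ramp B s ≤ 16 * B ^ 2 * s ^ 2 := by
  refine max_le (by positivity) ?_
  rcases le_total (4 * B * |s|) 1 with h | h
  · exact (min_le_right _ _).trans ((sub_nonpos.2 h).trans (by positivity))
  · refine (min_le_left _ _).trans ?_
    have := mul_self_le_mul_self zero_le_one h
    nlinarith [sq_abs s]

/-- Below 1/(2B) the first term suffices; above it the ramp equals 1 and |s| ≤ s²/(4B) + B by AM-GM.
-/
lemma abs_le_ramp {B : ℝ} (hB : 0 < B) (s : ℝ) :
    |s| ≤ 1 / (2 * B) + s ^ 2 / (4 * B) + B * ramp B s := by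
  have hr := (ramp_mem_Icc B s).1
  rcases le_total (4 * B * |s|) 2 with h | h
  · have h1 : |s| ≤ 1 / (2 * B) := by rw [le_div_iff₀ (by positivity)]; linarith
    have h2 : 0 ≤ s ^ 2 / (4 * B) := by positivity
    have h3 := mul_nonneg hB.le hr
    linarith
  · have e : ramp B s = 1 := by
      rw [ramp, min_eq_left (by linarith), max_eq_right zero_le_one]
    have h1 : 0 ≤ 1 / (2 * B) := by positivity
    have h2 : |s| ≤ s ^ 2 / (4 * B) + B := by
      rw [← sq_abs s, div_add' _ _ _ (by positivity), le_div_iff₀ (by positivity)]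
      nlinarith [sq_nonneg (|s| - 2 * B)]
    rw [e]
    linarith

/-- Integrating `abs_le_ramp` leaves 1/B - 1/(2B) - 1/(4B) = 1/(4B) for the ramp term; this replaces
a Paley–Zygmund estimate. -/
lemma le_integral_ramp {E : Type*} [MeasurableSpace E] {ν : Measure E} [IsProbabilityMeasure ν]
    {B : ℝ} (hB : 0 < B) {g : E → ℝ} (hg : MemLp g 2 ν) (h2 : ∫ x, g x ^ 2 ∂ν ≤ 1)
    (h1 : 1 / B ≤ ∫ x, |g x| ∂ν) : 1 / (4 * B ^ 2) ≤ ∫ x, ramp B (g x) ∂ν := by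
  have i1 : Integrable (fun x => |g x|) ν := (hg.integrable (by norm_num)).abs
  have i0 : Integrable (fun _ : E => 1 / (2 * B)) ν := integrable_const _
  have i2 : Integrable (fun x => g x ^ 2) ν := hg.integrable_sq
  have i3 : Integrable (fun x => ramp B (g x)) ν :=
    Integrable.of_mem_Icc 0 1 ((continuous_ramp B).comp_aestronglyMeasurable hg.1).aemeasurable
      (.of_forall fun x => ramp_mem_Icc B (g x))
  have i02 : Integrable (fun x => 1 / (2 * B) + g x ^ 2 / (4 * B)) ν := i0.add (i2.div_const _)
  have key : ∫ x, |g x| ∂ν ≤ ∫ x, (1 / (2 * B) + g x ^ 2 / (4 * B) + B * ramp B (g x)) ∂ν :=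
    integral_mono i1 (i02.add (i3.const_mul B)) fun x => abs_le_ramp hB (g x)
  rw [integral_add i02 (i3.const_mul B), integral_add i0 (i2.div_const _), integral_div (4 * B),
    integral_const_mul] at key
  simp only [integral_const, probReal_univ, one_smul] at key
  have h3 : (∫ x, g x ^ 2 ∂ν) / (4 * B) ≤ 1 / (4 * B) :=
    div_le_div_of_nonneg_right h2 (by positivity)
  have h4 : 1 / (4 * B) ≤ B * ∫ x, ramp B (g x) ∂ν := by
    have : 1 / B = 1 / (2 * B) + 1 / (4 * B) + 1 / (4 * B) := by field_simp; norm_num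
    linarith
  rw [div_le_iff₀ (by positivity)] at h4 ⊢
  nlinarith

/-! ### One subsequence: uniform bound over the sphere -/

section Block

variable {Ω : Type*} {mΩ : MeasurableSpace Ω} (P : Measure Ω)
  [IsProbabilityMeasure P] {n : ℕ} (𝓖 : Filtration ℕ mΩ)
  {Y : ℕ → Ω → EuclideanSpace ℝ (Fin n)} (hY : ∀ i, Measurable[𝓖 i] (Y i))
  (ν : Measure (EuclideanSpace ℝ (Fin n))) [IsProbabilityMeasure ν] {β : ℝ≥0∞}
  (hβ : ∀ i, ∫⁻ ω, tvDist (condLaw P (Y (i + 1)) (𝓖 i) ω) ν ∂P ≤ β)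
  {H : Type*} [NormedAddCommGroup H] [InnerProductSpace ℝ H] [MeasurableSpace H] [BorelSpace H]
  {D : EuclideanSpace ℝ (Fin n) → H} (hD : Measurable D) (hD2 : MemLp D 2 ν) {d : ℝ}
  (hDd : ∫ x, ‖D x‖ ^ 2 ∂ν ≤ d) {B : ℝ} (hB : 0 < B)
  (h2 : ∀ a : H, ‖a‖ = 1 → ∫ x, inner ℝ a (D x) ^ 2 ∂ν ≤ 1)
  (h1 : ∀ a : H, ‖a‖ = 1 → 1 / B ≤ ∫ x, |inner ℝ a (D x)| ∂ν)
  {m : ℕ} (hm : 25600 * B ^ 6 * d ≤ m)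

include hY hβ hD hD2 hDd hB h2 h1 hm

lemma measure_exists_finite_sum_ramp_lt_le [SecondCountableTopology H] {ι : Type*} [Fintype ι]
    {a : ι → H} (ha : ∀ i, ‖a i‖ = 1) :
    P {ω | ∃ i, ∑ j ∈ Finset.range m, ramp B (inner ℝ (a i) (D (Y (j + 1) ω))) <
        3 * m / (20 * B ^ 2)} ≤
      ENNReal.ofReal (Real.exp (-(m / (200 * B ^ 4)))) + m * β := by
  rcases isEmpty_or_nonempty ι with hι | hι
  · simp
  set φ : EuclideanSpace ℝ (Fin n) → ι → ℝ := fun x i => ramp B (inner ℝ (a i) (D x)) with hφdef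
  have hφ : Measurable φ := measurable_pi_lambda _ fun i =>
    (continuous_ramp B).measurable.comp (measurable_const.inner hD)
  have hφ01 : ∀ x i, φ x i ∈ Set.Icc (0 : ℝ) 1 := fun x i => ramp_mem_Icc _ _
  have hφi : ∀ i, Integrable (fun x => φ x i) ν := fun i =>
    Integrable.of_mem_Icc 0 1 ((measurable_pi_apply i).comp hφ).aemeasurable
      (.of_forall fun x => hφ01 x i)
  have hmean : ∀ i, 1 / (4 * B ^ 2) ≤ (∫ y, φ y ∂ν) i := fun i => by
    rw [eval_integral fun i => hφi i]
    exact le_integral_ramp hB (hD2.const_inner (a i)) (h2 _ (ha i)) (h1 _ (ha i))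
  have hK : ∫ x, ‖(8 * B) • D x‖ ^ 2 ∂ν ≤ 64 * B ^ 2 * d := by
    simp_rw [norm_smul, mul_pow, Real.norm_eq_abs, sq_abs]
    rw [integral_const_mul]
    nlinarith [mul_le_mul_of_nonneg_left hDd (sq_nonneg B)]
  -- The mean exceeds the threshold by 1/4 - 3/20 = 1/10 (times m/B²). The expected maximum takes at
  -- most half of this, and θ = 1/(5B²) minimises the remaining exponent -θm/(20B²) + mθ²/8. The
  -- factor 8B in z is twice the Lipschitz constant of the ramp.
  have main := measure_le_maxCoord_sum_le P 𝓖 hY ν hβ hφ hφ01 (fun i => (ha i).le)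
    (hD2.const_smul (8 * B)) (fun x s t => ?_) hK m (m / (10 * B ^ 2)) (1 / (5 * B ^ 2))
    (by positivity)
  · refine (measure_mono fun ω hω => ?_).trans (main.trans (add_le_add_left
      (ENNReal.ofReal_le_ofReal (Real.exp_le_exp.2 ?_)) _))
    · obtain ⟨i, hi⟩ := hω
      refine le_trans ?_ (le_maxCoord _ i)
      simp only [Finset.sum_apply, Pi.sub_apply, Finset.sum_sub_distrib, Finset.sum_const,
        Finset.card_range, nsmul_eq_mul]
      have := mul_le_mul_of_nonneg_left (hmean i) (Nat.cast_nonneg (α := ℝ) m)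
      have e : (m : ℝ) * (1 / (4 * B ^ 2)) = m / (10 * B ^ 2) + 3 * m / (20 * B ^ 2) := by
        field_simp; ring
      have hi' : ∑ j ∈ Finset.range m, φ (Y (j + 1) ω) i < 3 * m / (20 * B ^ 2) := hi
      linarith
    · have hs : √(m * (64 * B ^ 2 * d)) ≤ m / (20 * B ^ 2) := by
        rw [Real.sqrt_le_iff]
        refine ⟨by positivity, ?_⟩
        rw [div_pow, le_div_iff₀ (by positivity)]
        have := mul_le_mul_of_nonneg_left hm (Nat.cast_nonneg (α := ℝ) m)
        calc (m : ℝ) * (64 * B ^ 2 * d) * (20 * B ^ 2) ^ 2 = (m : ℝ) * (25600 * B ^ 6 * d) := by ring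
          _ ≤ (m : ℝ) ^ 2 := by rw [sq]; exact this
      have h5 := mul_le_mul_of_nonneg_left hs (show 0 ≤ 1 / (5 * B ^ 2) by positivity)
      have e : -(m / (200 * B ^ 4)) = 1 / (5 * B ^ 2) * (m / (20 * B ^ 2)) +
          m * ((1 / (5 * B ^ 2)) ^ 2 / 8) - 1 / (5 * B ^ 2) * (m / (10 * B ^ 2)) := by
        field_simp; ring
      linarith
  · rw [← mul_sub, abs_mul, abs_two]
    have := abs_ramp_sub_le hB.le (inner ℝ (a s) (D x)) (inner ℝ (a t) (D x))
    simp only [Pi.smul_apply, inner_smul_right]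
    rw [← mul_sub (8 * B), abs_mul, abs_of_pos (by positivity : 0 < 8 * B)]
    simp only [hφdef]
    linarith

/-- The strict inequality is an open condition on a, so a failure shows up on a dense sequence. The
event is thus covered by an increasing union of finite-class events with one common bound. -/
lemma measure_exists_sum_ramp_lt_le [SecondCountableTopology H] :
    P {ω | ∃ a : H, ‖a‖ = 1 ∧ ∑ j ∈ Finset.range m, ramp B (inner ℝ a (D (Y (j + 1) ω))) <
        3 * m / (20 * B ^ 2)} ≤
      ENNReal.ofReal (Real.exp (-(m / (200 * B ^ 4)))) + m * β := by
  rcases isEmpty_or_nonempty (Metric.sphere (0 : H) 1) with he | he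
  · have : ∀ a : H, ‖a‖ ≠ 1 := fun a ha => he.false ⟨a, by simpa using ha⟩
    simp [this]
  set u := TopologicalSpace.denseSeq (Metric.sphere (0 : H) 1)
  set s : ℕ → Set Ω := fun k => {ω | ∃ i : Fin k, ∑ j ∈ Finset.range m,
    ramp B (inner ℝ (u i : H) (D (Y (j + 1) ω))) < 3 * m / (20 * B ^ 2)} with hs
  have hmono : Monotone s := by
    rintro k l hkl ω ⟨i, hi⟩
    exact ⟨Fin.castLE hkl i, hi⟩
  have hsub : {ω | ∃ a : H, ‖a‖ = 1 ∧ ∑ j ∈ Finset.range m,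
      ramp B (inner ℝ a (D (Y (j + 1) ω))) < 3 * m / (20 * B ^ 2)} ⊆ ⋃ k, s k := by
    rintro ω ⟨a, ha, hlt⟩
    have hc : Continuous fun b : Metric.sphere (0 : H) 1 => ∑ j ∈ Finset.range m,
        ramp B (inner ℝ (b : H) (D (Y (j + 1) ω))) :=
      continuous_finsetSum _ fun j _ =>
        (continuous_ramp B).comp (continuous_subtype_val.inner continuous_const)
    obtain ⟨i, hi⟩ := (TopologicalSpace.denseRange_denseSeq (Metric.sphere (0 : H) 1)).exists_mem_open
      (isOpen_Iio.preimage hc) ⟨⟨a, by simpa using ha⟩, hlt⟩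
    exact Set.mem_iUnion.2 ⟨i + 1, Fin.last i, hi⟩
  refine (measure_mono hsub).trans ?_
  rw [hmono.measure_iUnion]
  exact iSup_le fun k => measure_exists_finite_sum_ramp_lt_le P 𝓖 hY ν hβ hD hD2 hDd hB h2 h1 hm
    fun i : Fin k => by simp

end Block

/-! ### Quadratic forms, smallest eigenvalue and whitening -/

section Matrices

variable {n : ℕ}

lemma isHermitian_secondMoment (ν : Measure (EuclideanSpace ℝ (Fin n))) :
    (secondMoment ν).IsHermitian := by
  ext i j; simp [secondMoment, outer, mul_comm]

lemma isHermitian_sampleCov (N : ℕ) (x : ℕ → EuclideanSpace ℝ (Fin n)) :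
    (sampleCov N x).IsHermitian := by
  have h : ∀ k i j, outer (x k) i j = outer (x k) j i := fun k i j => by simp [outer, mul_comm]
  ext i j
  simp [sampleCov, Matrix.sum_apply, h _ j i]

lemma inner_toEuclideanLin_eq_sum (A : Matrix (Fin n) (Fin n) ℝ) (v : EuclideanSpace ℝ (Fin n)) :
    inner ℝ v (Matrix.toEuclideanLin A v) = ∑ i, ∑ j, v i * v j * A i j := by
  simp only [PiLp.inner_apply, Matrix.toLpLin_apply, Matrix.mulVec, dotProduct]
  refine Finset.sum_congr rfl fun i _ => ?_
  simp only [RCLike.inner_apply, conj_trivial]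
  rw [Finset.sum_mul]
  exact Finset.sum_congr rfl fun j _ => by ring

lemma inner_outer (x v : EuclideanSpace ℝ (Fin n)) :
    ∑ i, ∑ j, v i * v j * outer x i j = inner ℝ x v ^ 2 := by
  simp only [PiLp.inner_apply, RCLike.inner_apply, conj_trivial]
  rw [sq, Finset.sum_mul_sum]
  exact Finset.sum_congr rfl fun i _ => Finset.sum_congr rfl fun j _ => by simp [outer]; ring

lemma inner_sampleCov (N : ℕ) (x : ℕ → EuclideanSpace ℝ (Fin n))
    (v : EuclideanSpace ℝ (Fin n)) :
    inner ℝ v (Matrix.toEuclideanLin (sampleCov N x) v) =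
      1 / (N : ℝ) * ∑ k ∈ Finset.Icc 1 N, inner ℝ (x k) v ^ 2 := by
  rw [inner_toEuclideanLin_eq_sum]
  simp_rw [← inner_outer, sampleCov, Matrix.smul_apply, Matrix.sum_apply, smul_eq_mul]
  simp_rw [Finset.mul_sum]
  rw [Finset.sum_comm (s := Finset.Icc 1 N)]
  refine Finset.sum_congr rfl fun i _ => ?_
  rw [Finset.sum_comm (s := Finset.Icc 1 N)]
  exact Finset.sum_congr rfl fun j _ => Finset.sum_congr rfl fun k _ => by ring

lemma toEuclideanLin_eigenvectorBasis {A : Matrix (Fin n) (Fin n) ℝ} (hA : A.IsHermitian)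
    (j : Fin n) : Matrix.toEuclideanLin A (hA.eigenvectorBasis j) =
      hA.eigenvalues j • hA.eigenvectorBasis j := by
  rw [Matrix.toLpLin_apply, hA.mulVec_eigenvectorBasis]
  rfl

lemma inner_toEuclideanLin_eq_sum_eigenvalues {A : Matrix (Fin n) (Fin n) ℝ}
    (hA : A.IsHermitian) (v : EuclideanSpace ℝ (Fin n)) :
    inner ℝ v (Matrix.toEuclideanLin A v) =
      ∑ j, hA.eigenvalues j * inner ℝ (hA.eigenvectorBasis j) v ^ 2 := by
  conv_lhs => rw [← hA.eigenvectorBasis.sum_repr' v]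
  rw [map_sum, hA.eigenvectorBasis.sum_repr' v, inner_sum]
  refine Finset.sum_congr rfl fun j _ => ?_
  rw [map_smul, toEuclideanLin_eigenvectorBasis, inner_smul_right, inner_smul_right,
    real_inner_comm v]
  ring

lemma lambdaMin_le_eigenvalues {A : Matrix (Fin n) (Fin n) ℝ} (hA : A.IsHermitian) (j : Fin n) :
    lambdaMin A ≤ hA.eigenvalues j :=
  csInf_le (Matrix.finite_real_spectrum).bddBelow (hA.eigenvalues_mem_spectrum_real j)

lemma le_lambdaMin (hn : 0 < n) {A : Matrix (Fin n) (Fin n) ℝ} (hA : A.IsHermitian) {c : ℝ}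
    (h : ∀ v : EuclideanSpace ℝ (Fin n), ‖v‖ = 1 →
      c ≤ inner ℝ v (Matrix.toEuclideanLin A v)) : c ≤ lambdaMin A := by
  refine le_csInf ⟨_, hA.eigenvalues_mem_spectrum_real ⟨0, hn⟩⟩ fun μ hμ => ?_
  rw [hA.spectrum_real_eq_range_eigenvalues] at hμ
  obtain ⟨j, rfl⟩ := hμ
  have h1 := hA.eigenvectorBasis.norm_eq_one j
  have := h _ h1
  rwa [toEuclideanLin_eigenvectorBasis, inner_smul_right, real_inner_self_eq_norm_sq, h1, one_pow,
    mul_one] at this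

lemma lambdaMin_of_eq_zero (hn : n = 0) (A : Matrix (Fin n) (Fin n) ℝ) : lambdaMin A = 0 := by
  subst hn
  have : spectrum ℝ A = ∅ := spectrum.of_subsingleton A
  rw [lambdaMin, this, Real.sInf_empty]

variable {ν : Measure (EuclideanSpace ℝ (Fin n))} (hν : MemLp (fun x => x) 2 ν)

include hν

lemma memLp_coord (i : Fin n) : MemLp (fun x : EuclideanSpace ℝ (Fin n) => x i) 2 ν := by
  simpa only [EuclideanSpace.inner_single_left, map_one, one_mul] using
    hν.const_inner (𝕜 := ℝ) (EuclideanSpace.single i (1 : ℝ))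

lemma integral_inner_sq (v : EuclideanSpace ℝ (Fin n)) :
    ∫ x, inner ℝ x v ^ 2 ∂ν = inner ℝ v (Matrix.toEuclideanLin (secondMoment ν) v) := by
  rw [inner_toEuclideanLin_eq_sum]
  simp_rw [← inner_outer]
  have hi : ∀ i j, Integrable (fun x => v i * v j * outer x i j) ν := fun i j =>
    ((memLp_coord hν i).integrable_mul (memLp_coord hν j)).const_mul _
  rw [integral_finsetSum _ fun i _ => integrable_finsetSum _ fun j _ => hi i j]
  refine Finset.sum_congr rfl fun i _ => ?_
  rw [integral_finsetSum _ fun j _ => hi i j]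
  exact Finset.sum_congr rfl fun j _ => integral_const_mul _ _

/-- A whitening map for a measure with positive definite second moment matrix. -/
lemma exists_whitening {l : ℝ} (hl : 0 < l) (h : l ≤ lambdaMin (secondMoment ν)) :
    ∃ D : EuclideanSpace ℝ (Fin n) →L[ℝ] EuclideanSpace ℝ (Fin n),
      (∀ a, ∃ t, ∀ x, inner ℝ a (D x) = inner ℝ x t) ∧
      (∀ a, ∫ x, inner ℝ a (D x) ^ 2 ∂ν = ‖a‖ ^ 2) ∧
      ∀ t, ‖t‖ = 1 → ∃ c a, l ≤ c ^ 2 ∧ ‖a‖ = 1 ∧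
        ∀ x, inner ℝ x t = c * inner ℝ a (D x) := by
  set hA := isHermitian_secondMoment ν
  set v := hA.eigenvectorBasis
  set r := hA.eigenvalues
  have hr : ∀ j, l ≤ r j := fun j => h.trans (lambdaMin_le_eigenvalues hA j)
  have hr0 : ∀ j, 0 < r j := fun j => hl.trans_le (hr j)
  set M : (Fin n → ℝ) → EuclideanSpace ℝ (Fin n) →L[ℝ] EuclideanSpace ℝ (Fin n) := fun d =>
    ∑ j, d j • (innerSL ℝ (v j)).smulRight (v j) with hM
  have hMx : ∀ d x, M d x = ∑ j, (d j * inner ℝ (v j) x) • v j := fun d x => by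
    simp [hM, smul_smul]
  have hMc : ∀ d x j, inner ℝ (v j) (M d x) = d j * inner ℝ (v j) x := fun d x j => by
    rw [hMx]; exact v.orthonormal.inner_right_fintype _ j
  have hMs : ∀ d x y, inner ℝ x (M d y) = inner ℝ y (M d x) := fun d x y => by
    rw [hMx, hMx, inner_sum, inner_sum]
    refine Finset.sum_congr rfl fun j _ => ?_
    rw [inner_smul_right, inner_smul_right, real_inner_comm x, real_inner_comm y]
    ring
  have hnorm : ∀ x, ‖x‖ ^ 2 = ∑ j, inner ℝ (v j) x ^ 2 := fun x => by
    rw [← v.sum_sq_norm_inner_right x]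
    simp
  have hquad : ∀ w, ∫ x, inner ℝ x w ^ 2 ∂ν = ∑ j, r j * inner ℝ (v j) w ^ 2 := fun w => by
    rw [integral_inner_sq hν, inner_toEuclideanLin_eq_sum_eigenvalues hA]
  refine ⟨M fun j => (√(r j))⁻¹, fun a => ⟨_, fun x => hMs _ a x⟩, fun a => ?_, fun t ht => ?_⟩
  · simp_rw [hMs _ a]
    rw [hquad, hnorm]
    refine Finset.sum_congr rfl fun j _ => ?_
    rw [hMc, mul_pow, inv_pow, Real.sq_sqrt (hr0 j).le, mul_inv_cancel_left₀ (hr0 j).ne']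
  -- Here b is the square root of the second moment matrix applied to t, so ‖b‖² is the second
  -- moment of ⟨x,t⟩; c and a are its norm and direction.
  · set b := M (fun j => √(r j)) t with hb
    have hb2 : l ≤ ‖b‖ ^ 2 := by
      calc l = l * ‖t‖ ^ 2 := by rw [ht]; ring
        _ = ∑ j, l * inner ℝ (v j) t ^ 2 := by rw [hnorm, Finset.mul_sum]
        _ ≤ ∑ j, r j * inner ℝ (v j) t ^ 2 :=
          Finset.sum_le_sum fun j _ => mul_le_mul_of_nonneg_right (hr j) (sq_nonneg _)
        _ = ‖b‖ ^ 2 := by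
          rw [hnorm]
          refine Finset.sum_congr rfl fun j _ => ?_
          rw [hb, hMc, mul_pow, Real.sq_sqrt (hr0 j).le]
    have hb0 : ‖b‖ ≠ 0 := fun h0 => by rw [h0] at hb2; norm_num at hb2; linarith
    refine ⟨‖b‖, ‖b‖⁻¹ • b, hb2, ?_, fun x => ?_⟩
    · rw [norm_smul, norm_inv, norm_norm, inv_mul_cancel₀ hb0]
    · rw [real_inner_smul_left, mul_inv_cancel_left₀ hb0, hMs, ← v.sum_inner_mul_inner x,
        ← v.sum_inner_mul_inner x]
      refine Finset.sum_congr rfl fun j _ => ?_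
      rw [hMc, hb, hMc, inv_mul_cancel_left₀ (Real.sqrt_pos.2 (hr0 j)).ne']

lemma integral_norm_whitening_sq {D : EuclideanSpace ℝ (Fin n) →L[ℝ] EuclideanSpace ℝ (Fin n)}
    (hD : ∀ a, ∫ x, inner ℝ a (D x) ^ 2 ∂ν = ‖a‖ ^ 2) : ∫ x, ‖D x‖ ^ 2 ∂ν = n := by
  have e : ∀ x, ‖D x‖ ^ 2 = ∑ i, inner ℝ (EuclideanSpace.basisFun (Fin n) ℝ i) (D x) ^ 2 :=
    fun x => by
      rw [← (EuclideanSpace.basisFun (Fin n) ℝ).sum_sq_norm_inner_right (D x)]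
      simp
  have hDm : MemLp (fun x => D x) 2 ν := D.comp_memLp' hν
  simp_rw [e]
  rw [integral_finsetSum _ fun i _ => (hDm.const_inner _).integrable_sq]
  simp_rw [hD, OrthonormalBasis.norm_eq_one]
  simp

/-- The `L²`-norm of a nondegenerate marginal is controlled by its `L¹`-norm. -/
lemma integral_inner_sq_le_of_contractivity [IsProbabilityMeasure ν] {B : ℝ}
    (hB : contractivity ν ≤ ENNReal.ofReal B) (t : EuclideanSpace ℝ (Fin n))
    (ht : 0 < ∫ x, inner ℝ x t ^ 2 ∂ν) :
    0 < B ∧ √(∫ x, inner ℝ x t ^ 2 ∂ν) ≤ B * ∫ x, |inner ℝ x t| ∂ν := by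
  have hc : ‖t‖ ≠ 0 := fun h0 => by simp [norm_eq_zero.1 h0] at ht
  set f : EuclideanSpace ℝ (Fin n) → ℝ := fun x => inner ℝ x (‖t‖⁻¹ • t) with hf
  have e : ∀ x, inner ℝ x t = ‖t‖ * f x := fun x => by
    rw [hf]; simp only [inner_smul_right]; rw [mul_inv_cancel_left₀ hc]
  have hfm : MemLp f 2 ν := hν.inner_const _
  have hfi : Integrable f ν := hfm.integrable (by norm_num)
  have hunit : ‖‖t‖⁻¹ • t‖ = 1 := by
    rw [norm_smul, norm_inv, norm_norm, inv_mul_cancel₀ hc]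
  have hle : eLpNorm f 2 ν / eLpNorm f 1 ν ≤ ENNReal.ofReal B :=
    (le_iSup₂ (f := fun (t : EuclideanSpace ℝ (Fin n)) (_ : ‖t‖ = 1) =>
      eLpNorm (fun x => inner ℝ x t) 2 ν / eLpNorm (fun x => inner ℝ x t) 1 ν)
      (‖t‖⁻¹ • t) hunit).trans hB
  have e1 : eLpNorm f 1 ν = ENNReal.ofReal (∫ x, |f x| ∂ν) := by
    rw [eLpNorm_one_eq_lintegral_enorm, ← ofReal_integral_norm_eq_lintegral_enorm hfi]
    rfl
  have e2 : eLpNorm f 2 ν = ENNReal.ofReal (√(∫ x, f x ^ 2 ∂ν)) := by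
    rw [hfm.eLpNorm_eq_integral_rpow_norm (by norm_num) (by norm_num), Real.sqrt_eq_rpow]
    simp
  rw [ENNReal.div_le_iff_le_mul (Or.inr ENNReal.ofReal_ne_top)
    (Or.inl (e1 ▸ ENNReal.ofReal_ne_top)), e1, e2,
    ← ENNReal.ofReal_mul' (integral_nonneg fun x => abs_nonneg _)] at hle
  simp_rw [e, mul_pow, abs_mul, abs_norm, integral_const_mul] at ht ⊢
  have ht' : 0 < ∫ x, f x ^ 2 ∂ν := pos_of_mul_pos_right ht (sq_nonneg _)
  have hs := Real.sqrt_pos.2 ht'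
  -- `ENNReal.ofReal` truncates at 0; the comparison passes to the reals because the L² norm is
  -- positive. This also yields B > 0.
  have key := (ENNReal.ofReal_le_ofReal_iff'.1 hle).resolve_right hs.not_ge
  refine ⟨pos_of_mul_pos_left (hs.trans_le key) (integral_nonneg fun x => abs_nonneg _), ?_⟩
  rw [Real.sqrt_mul (sq_nonneg _), Real.sqrt_sq (norm_nonneg _)]
  nlinarith [mul_le_mul_of_nonneg_left key (norm_nonneg t)]

end Matrices

/-! ### Interleaved blocks and the choice of constants -/

lemma sum_blocks_le_sum_Icc {f : ℕ → ℝ} (hf : ∀ i, 0 ≤ f i) {k m N : ℕ} (h : (m + 1) * k ≤ N) :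
    ∑ j ∈ Finset.Icc 1 k, ∑ i ∈ Finset.range m, f (j + (i + 1) * k) ≤
      ∑ i ∈ Finset.Icc 1 N, f i := by
  rw [← Finset.sum_product' (f := fun j i => f (j + (i + 1) * k))]
  have hinj : Set.InjOn (fun p : ℕ × ℕ => p.1 + (p.2 + 1) * k)
      (Finset.Icc 1 k ×ˢ Finset.range m : Finset (ℕ × ℕ)) := by
    rintro ⟨j, i⟩ hp ⟨j', i'⟩ hp' he
    simp only [Finset.coe_product, Set.mem_prod, Finset.mem_coe, Finset.mem_Icc] at hp hp' he
    have hi : i = i' := by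
      rcases lt_trichotomy i i' with hlt | heq | hlt
      · have := Nat.mul_le_mul_right k (show i + 1 + 1 ≤ i' + 1 by omega)
        rw [add_mul (i + 1)] at this
        omega
      · exact heq
      · have := Nat.mul_le_mul_right k (show i' + 1 + 1 ≤ i + 1 by omega)
        rw [add_mul (i' + 1)] at this
        omega
    subst hi
    simpa using he
  rw [← Finset.sum_image (g := fun p : ℕ × ℕ => p.1 + (p.2 + 1) * k) hinj]
  refine Finset.sum_le_sum_of_subset_of_nonneg (fun i hi => ?_) fun i _ _ => hf i
  obtain ⟨⟨j, i⟩, hp, rfl⟩ := Finset.mem_image.1 hi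
  simp only [Finset.mem_product, Finset.mem_Icc, Finset.mem_range] at hp ⊢
  have := Nat.mul_le_mul_right k (show i + 1 + 1 ≤ m + 1 by omega)
  rw [add_mul (i + 1)] at this
  omega

/-- Existence of a gap `k` and a block length `m` fitting into a sample of size `N`. -/
lemma exists_block_sizes {B r d δ T : ℝ} {N : ℕ} (hB : 1 ≤ B) (hr : 1 ≤ r) (hd : 1 ≤ d)
    (hδ : δ ∈ Set.Ioo (0 : ℝ) 1) (hT : 1 / 2 ≤ T)
    (hN : T * (max (65536 * B ^ 6 * r * d) (512 * B ^ 4 * Real.log (4 * T / δ)) + 1) ≤ N) :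
    ∃ k m : ℕ, 1 ≤ k ∧ T ≤ k ∧ (m + 1) * k ≤ N ∧ 25600 * B ^ 6 * d ≤ m ∧
      Real.exp (-(m / (200 * B ^ 4))) ≤ δ / (2 * k) ∧ (5 * N : ℝ) ≤ 6 * (k * m) := by
  set M := max (65536 * B ^ 6 * r * d) (512 * B ^ 4 * Real.log (4 * T / δ)) with hM
  have hB6 : 1 ≤ B ^ 6 := one_le_pow₀ hB
  have hB6d : 1 ≤ B ^ 6 * d := one_le_mul_of_one_le_of_one_le hB6 hd
  have hM1 : 65536 * (B ^ 6 * d) ≤ M := by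
    refine le_trans ?_ (le_max_left _ _)
    nlinarith
  have hM2 : 512 * B ^ 4 * Real.log (4 * T / δ) ≤ M := le_max_right _ _
  have hk0 : 0 < ⌈T⌉₊ := Nat.ceil_pos.2 (by linarith)
  have hk1 : (1 : ℝ) ≤ ⌈T⌉₊ := by exact_mod_cast hk0
  -- This is where T ≥ 1/2 is needed: rounding up at most doubles the gap.
  have hk2 : (⌈T⌉₊ : ℝ) ≤ 2 * T := by
    rcases le_total T 1 with h | h
    · have : ⌈T⌉₊ ≤ 1 := Nat.ceil_le.2 (by simpa using h)
      have : (⌈T⌉₊ : ℝ) ≤ 1 := by exact_mod_cast this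
      linarith
    · linarith [Nat.ceil_lt_add_one (show 0 ≤ T by linarith)]
  have hTk : T ≤ ⌈T⌉₊ := Nat.le_ceil T
  generalize ⌈T⌉₊ = k at *
  have hMk : (M + 1) * k ≤ 2 * N := by nlinarith
  have hkN : k ≤ N := by
    have : (k : ℝ) ≤ N := by nlinarith
    exact_mod_cast this
  -- One term per subsequence is given up, since the first k samples serve only for conditioning.
  obtain ⟨m, hm⟩ : ∃ m, N / k = m + 1 :=
    ⟨N / k - 1, by have := Nat.div_pos hkN hk0; omega⟩
  have hmk : (m + 1) * k ≤ N := hm ▸ Nat.div_mul_le_self N k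
  have hNlt : (N : ℝ) < (m + 2) * k := by
    have := Nat.lt_mul_of_div_lt (show N / k < m + 2 by omega) hk0
    have h' : N < (m + 2) * k := by linarith [this, mul_comm k (m + 2)]
    exact_mod_cast h'
  have hMm : M + 1 < 2 * (m + 2) := by
    refine lt_of_mul_lt_mul_right ?_ (show (0 : ℝ) ≤ k by linarith)
    linarith
  -- From M + 1 < 2(m + 2), m is about M/2 or more; this accounts for 65536 against 25600 and 512
  -- against 200. The last bound follows from N < (m + 2)k once m ≥ 10.
  refine ⟨k, m, hk0, hTk, hmk, by linarith, ?_, by nlinarith⟩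
  have hk' : (0 : ℝ) < k := by linarith
  have hlog1 : Real.log (2 * k / δ) ≤ Real.log (4 * T / δ) := by
    refine Real.log_le_log (div_pos (by linarith) hδ.1) (div_le_div_of_nonneg_right ?_ hδ.1.le)
    linarith
  have hlog0 : 0 ≤ Real.log (2 * k / δ) := by
    refine Real.log_nonneg ((one_le_div hδ.1).2 ?_)
    linarith [hδ.2]
  have hlog : Real.log (2 * k / δ) ≤ m / (200 * B ^ 4) := by
    rw [le_div_iff₀ (by positivity)]
    have := mul_le_mul_of_nonneg_left hlog1 (show 0 ≤ B ^ 4 by positivity)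
    nlinarith
  calc Real.exp (-(m / (200 * B ^ 4))) ≤ Real.exp (-Real.log (2 * k / δ)) :=
        Real.exp_le_exp.2 (neg_le_neg hlog)
    _ = δ / (2 * k) := by
        rw [Real.exp_neg, Real.exp_log (div_pos (by linarith) hδ.1), inv_div]

/-- Uses ρ ≤ exp(-(1-ρ)). -/
lemma mul_pow_le_div {Γ ρ δ : ℝ} (hΓ : 0 < Γ) (hρ : ρ ∈ Set.Ioo (0 : ℝ) 1) (hδ : 0 < δ)
    {N k : ℕ} (hN : 0 < N) (hk : 1 / (1 - ρ) * Real.log (2 * Γ * N / δ) ≤ k) :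
    Γ * ρ ^ k ≤ δ / (2 * N) := by
  have hN' : (0 : ℝ) < N := by exact_mod_cast hN
  have h1 : 0 < 1 - ρ := by linarith [hρ.2]
  rw [one_div_mul_eq_div, div_le_iff₀ h1] at hk
  have h2 : ρ ^ k ≤ Real.exp (-Real.log (2 * Γ * N / δ)) := by
    calc ρ ^ k ≤ Real.exp (-(1 - ρ)) ^ k := by
          refine pow_le_pow_left₀ hρ.1.le ?_ k
          linarith [Real.add_one_le_exp (-(1 - ρ))]
      _ = Real.exp (-(k * (1 - ρ))) := by rw [← Real.exp_nat_mul]; ring_nf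
      _ ≤ _ := Real.exp_le_exp.2 (neg_le_neg hk)
  rw [Real.exp_neg, Real.exp_log (by positivity), inv_div] at h2
  refine (mul_le_mul_of_nonneg_left h2 hΓ.le).trans_eq ?_
  field_simp

/-- Each square is at least ℓ/(16B²) times the ramp, and km ≥ 5N/6, so the constant is
(1/16)(3/20)(5/6) = 1/128. -/
lemma le_lambdaMin_sampleCov {n : ℕ} (hn : 0 < n) {N k m : ℕ} (hN : 0 < N)
    (h : (m + 1) * k ≤ N) (h5 : (5 * N : ℝ) ≤ 6 * (k * m)) {l B : ℝ} (hl : 0 < l) (hB : 0 < B)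
    {D : EuclideanSpace ℝ (Fin n) →L[ℝ] EuclideanSpace ℝ (Fin n)}
    (hD : ∀ t, ‖t‖ = 1 → ∃ c a, l ≤ c ^ 2 ∧ ‖a‖ = 1 ∧
        ∀ x, inner ℝ x t = c * inner ℝ a (D x)) {x : ℕ → EuclideanSpace ℝ (Fin n)}
    (hx : ∀ j ∈ Finset.Icc 1 k, ∀ a, ‖a‖ = 1 → 3 * m / (20 * B ^ 2) ≤
      ∑ i ∈ Finset.range m, ramp B (inner ℝ a (D (x (j + (i + 1) * k))))) :
    l / (128 * B ^ 4) ≤ lambdaMin (sampleCov N x) := by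
  refine le_lambdaMin hn (isHermitian_sampleCov N x) fun t ht => ?_
  obtain ⟨c, a, hlc, ha, hc⟩ := hD t ht
  have hN' : (0 : ℝ) < N := by exact_mod_cast hN
  rw [inner_sampleCov, one_div_mul_eq_div, le_div_iff₀ hN']
  refine le_trans ?_ (sum_blocks_le_sum_Icc (f := fun i => inner ℝ (x i) t ^ 2)
    (fun i => sq_nonneg _) h)
  have hterm : ∀ y, l / (16 * B ^ 2) * ramp B (inner ℝ a (D y)) ≤ inner ℝ y t ^ 2 := fun y => by
    have h1 := ramp_le_sq B (inner ℝ a (D y))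
    have h2 := (ramp_mem_Icc B (inner ℝ a (D y))).1
    rw [hc, mul_pow, div_mul_eq_mul_div, div_le_iff₀ (by positivity)]
    nlinarith [mul_le_mul_of_nonneg_left h1 hl.le,
      mul_le_mul_of_nonneg_right hlc (show 0 ≤ inner ℝ a (D y) ^ 2 * (16 * B ^ 2) by positivity)]
  calc l / (128 * B ^ 4) * N
      = l / (640 * B ^ 4) * (5 * N) := by field_simp; norm_num
    _ ≤ l / (640 * B ^ 4) * (6 * (k * m)) := mul_le_mul_of_nonneg_left h5 (by positivity)
    _ = ∑ j ∈ Finset.Icc 1 k, l / (16 * B ^ 2) * (3 * m / (20 * B ^ 2)) := by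
        simp only [Finset.sum_const, Nat.card_Icc, add_tsub_cancel_right, nsmul_eq_mul]
        field_simp
        ring
    _ ≤ ∑ j ∈ Finset.Icc 1 k, ∑ i ∈ Finset.range m, inner ℝ (x (j + (i + 1) * k)) t ^ 2 := by
        refine Finset.sum_le_sum fun j hj => ?_
        refine (mul_le_mul_of_nonneg_left (hx j hj a ha) (by positivity)).trans ?_
        rw [Finset.mul_sum]
        exact Finset.sum_le_sum fun i _ => hterm _

end MixingCovariance

/-! ### Assembly -/

open MixingCovariance in
theorem mainTheorem2
    {Ω : Type*} {m : MeasurableSpace Ω} (P : Measure Ω) [IsProbabilityMeasure P]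
    (n : ℕ) (𝓕 : Filtration ℕ m) (X : ℕ → Ω → EuclideanSpace ℝ (Fin n))
    (hX : ∀ k, 1 ≤ k → Measurable[𝓕 k] (X k))
    (ν : Measure (EuclideanSpace ℝ (Fin n))) [IsProbabilityMeasure ν]
    (hν : MemLp (fun x => x) 2 ν)
    (Γ ρ δ : ℝ) (hΓ : 0 < Γ) (hρ : ρ ∈ Set.Ioo (0 : ℝ) 1) (hδ : δ ∈ Set.Ioo (0 : ℝ) 1)
    (hmix : ∀ k, 1 ≤ k →
      MixingCovariance.betaMixing P 𝓕 X ν k ≤ ENNReal.ofReal (Γ * ρ ^ k))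
    (l L B : ℝ) (hl : 0 < l)
    (hlmin : l ≤ MixingCovariance.lambdaMin (MixingCovariance.secondMoment ν))
    (hminL : MixingCovariance.lambdaMin (MixingCovariance.secondMoment ν) ≤ L)
    (hB : MixingCovariance.contractivity ν ≤ ENNReal.ofReal B)
    (N : ℕ)
    (hblock : 1 / 2 ≤ 1 / (1 - ρ) * Real.log (2 * Γ * N / δ))
    (hN : 1 / (1 - ρ) * Real.log (2 * Γ * N / δ) *
        (max (65536 * B ^ 6 * (L / l) * n)
          (512 * B ^ 4 * Real.log (4 / (δ * (1 - ρ)) * Real.log (2 * Γ * N / δ))) + 1) ≤ N) :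
    ENNReal.ofReal (1 - δ) ≤
      P {ω | l / (128 * B ^ 4) ≤
        MixingCovariance.lambdaMin (MixingCovariance.sampleCov N (fun k => X k ω))} := by
  -- For n = 0 the spectrum is empty and its `sInf` is 0, contradicting ℓ > 0.
  have hn : 0 < n := Nat.pos_of_ne_zero fun h0 => by
    rw [lambdaMin_of_eq_zero h0] at hlmin
    linarith
  -- For N = 0 the convention `Real.log 0 = 0` contradicts `hblock`.
  have hN0 : 0 < N := Nat.pos_of_ne_zero fun h0 => by
    rw [h0] at hblock
    norm_num at hblock
  obtain ⟨D, hDt, hDiso, hDrep⟩ := exists_whitening hν hl hlmin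
  have hDm : MemLp (fun x => D x) 2 ν := D.comp_memLp' hν
  have hmarg : ∀ a, ‖a‖ = 1 → 0 < B ∧ 1 ≤ B * ∫ x, |inner ℝ a (D x)| ∂ν := fun a ha => by
    obtain ⟨t, ht⟩ := hDt a
    have h1 := hDiso a
    rw [ha, one_pow] at h1
    simp_rw [ht] at h1 ⊢
    have := integral_inner_sq_le_of_contractivity hν hB t (by rw [h1]; exact one_pos)
    rwa [h1, Real.sqrt_one] at this
  obtain ⟨a₀, ha₀⟩ : ∃ a : EuclideanSpace ℝ (Fin n), ‖a‖ = 1 :=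
    ⟨EuclideanSpace.single ⟨0, hn⟩ 1, by simp⟩
  have hB0 : 0 < B := (hmarg a₀ ha₀).1
  -- A whitened marginal has L¹ norm at most its L² norm, which is 1.
  have hB1 : 1 ≤ B := by
    have hg : MemLp (fun x => inner ℝ a₀ (D x)) 2 ν := hDm.const_inner a₀
    have h1 := (integral_sqrt_le (fun x => sq_nonneg (inner ℝ a₀ (D x))) hg.integrable_sq).2
    simp_rw [Real.sqrt_sq_eq_abs] at h1
    rw [hDiso, ha₀, one_pow, Real.sqrt_one] at h1
    nlinarith [(hmarg a₀ ha₀).2]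
  have hT : 4 / (δ * (1 - ρ)) * Real.log (2 * Γ * N / δ) =
      4 * (1 / (1 - ρ) * Real.log (2 * Γ * N / δ)) / δ := by
    rw [div_mul_eq_mul_div, div_mul_eq_mul_div, one_mul, mul_div_assoc', div_div, mul_comm δ]
  rw [hT] at hN
  obtain ⟨k, M, hk1, hTk, hkM, hM, hexp, h5⟩ := exists_block_sizes hB1
    ((one_le_div hl).2 (hlmin.trans hminL)) (by exact_mod_cast hn) hδ hblock hN
  have hβ := mul_pow_le_div hΓ hρ hδ.1 hN0 hTk
  set bad : ℕ → Set Ω := fun j => {ω | ∃ a : EuclideanSpace ℝ (Fin n), ‖a‖ = 1 ∧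
    ∑ i ∈ Finset.range M, ramp B (inner ℝ a (D (X (j + (i + 1) * k) ω))) <
      3 * M / (20 * B ^ 2)} with hbad
  have hbadP : ∀ j ∈ Finset.Icc 1 k, P (bad j) ≤ ENNReal.ofReal (δ / k) := fun j hj => by
    have hj1 := (Finset.mem_Icc.1 hj).1
    have hmono : Monotone fun i => j + i * k := fun i i' hi =>
      Nat.add_le_add_left (Nat.mul_le_mul_right k hi) j
    -- The filtration is sampled along the same progression; j ≥ 1 keeps every conditioning time
    -- within the supremum defining `betaMixing`.
    have key := measure_exists_sum_ramp_lt_le P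
      ⟨fun i => 𝓕 (j + i * k), fun _ _ hi => 𝓕.mono (hmono hi), fun i => 𝓕.le _⟩
      (Y := fun i => X (j + i * k)) (fun i => hX _ (by omega)) ν
      (β := ENNReal.ofReal (δ / (2 * N))) (fun i => ?_) (D := D) D.continuous.measurable hDm
      (integral_norm_whitening_sq hν hDiso).le hB0
      (fun a ha => by rw [hDiso, ha, one_pow])
      (fun a ha => by rw [div_le_iff₀' hB0]; exact (hmarg a ha).2) hM
    · refine key.trans ?_
      rw [← ENNReal.ofReal_natCast, ← ENNReal.ofReal_mul (Nat.cast_nonneg _),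
        ← ENNReal.ofReal_add (Real.exp_pos _).le
          (mul_nonneg (Nat.cast_nonneg _) (div_nonneg hδ.1.le (by positivity)))]
      refine ENNReal.ofReal_le_ofReal ?_
      have hk' : (0 : ℝ) < k := by exact_mod_cast hk1
      have hN' : (0 : ℝ) < N := by exact_mod_cast hN0
      have hkM' : ((M : ℝ) + 1) * k ≤ N := by exact_mod_cast hkM
      -- Since Mk ≤ N, the total exchange cost is half of the budget δ/k; the exponential tail takes
      -- the other half.
      have h1 : (M : ℝ) * (δ / (2 * N)) ≤ δ / (2 * k) := by
        rw [mul_div_assoc', div_le_div_iff₀ (by positivity) (by positivity)]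
        nlinarith [mul_le_mul_of_nonneg_left hkM' hδ.1.le, mul_pos hδ.1 hk']
      have h2 : δ / k = δ / (2 * k) + δ / (2 * k) := by field_simp; norm_num
      linarith
    · have h1 : ∫⁻ ω, tvDist (condLaw P (X (j + i * k + k)) (𝓕 (j + i * k)) ω) ν ∂P ≤
          betaMixing P 𝓕 X ν k :=
        le_iSup₂ (f := fun (t : ℕ) (_ : 1 ≤ t) =>
          ∫⁻ ω, tvDist (condLaw P (X (t + k)) (𝓕 t) ω) ν ∂P) (j + i * k) (by omega)
      have e : j + (i + 1) * k = j + i * k + k := by ring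
      rw [e]
      exact h1.trans ((hmix k hk1).trans (ENNReal.ofReal_le_ofReal hβ))
  have hunion : P (⋃ j ∈ Finset.Icc 1 k, bad j) ≤ ENNReal.ofReal δ := by
    refine (measure_biUnion_finset_le _ _).trans ((Finset.sum_le_sum hbadP).trans_eq ?_)
    have hk' : (k : ℝ) ≠ 0 := by exact_mod_cast (Nat.one_le_iff_ne_zero.1 hk1)
    rw [Finset.sum_const, Nat.card_Icc, add_tsub_cancel_right, nsmul_eq_mul,
      ← ENNReal.ofReal_natCast, ← ENNReal.ofReal_mul (Nat.cast_nonneg _), mul_div_cancel₀ _ hk']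
  rw [ENNReal.ofReal_sub _ hδ.1.le, ENNReal.ofReal_one, tsub_le_iff_right]
  calc (1 : ℝ≥0∞) = P Set.univ := measure_univ.symm
    _ ≤ P ({ω | l / (128 * B ^ 4) ≤ lambdaMin (sampleCov N (fun k => X k ω))} ∪
          ⋃ j ∈ Finset.Icc 1 k, bad j) := by
        refine measure_mono fun ω _ => ?_
        by_cases hω : ω ∈ ⋃ j ∈ Finset.Icc 1 k, bad j
        · exact Or.inr hω
        · refine Or.inl (le_lambdaMin_sampleCov hn hN0 hkM h5 hl hB0 hDrep fun j hj a ha => ?_)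
          by_contra! hlt
          exact hω (Set.mem_biUnion hj ⟨a, ha, hlt⟩)
    _ ≤ _ := (measure_union_le _ _).trans (add_le_add_right hunion _)
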